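/- **Lower bound on the error of private histograms.** Let $[d]=\{1,\dots,d\}$ be the set of items and $\mathcal Z$ an arbitrary measurable space. A randomized map $Q:[d]\to\mathcal Z$ is $(\varepsilon,\delta)$-LDP if $\Pr[Q(v)\in S]\le e^{\varepsilon}\Pr[Q(v')\in S]+\delta$ for all $v,v'\in[d]$ and all measurable $S\subseteq\mathcal Z$. Given items $v_1,\dots,v_n\in[d]$, let $f\in[0,1]^d$, $f(u)=\frac1n\#\{i: v_i=u\}$, be their frequency vector. For every $C>0$ there are constants $c,\kappa>0$, depending only on $C$, such that the following holds for all integers $n\ge 2$, $d\ge 1$, all $0<\varepsilon\le C$ and all $0\le\delta\le\frac{\kappa}{n\log n}$ (so, for all sufficiently large $n$, for any $\varepsilon=O(1)$ and any $0\le\delta\le o\!\left(\frac1{n\log n}\right)$). For all $(\varepsilon,\delta)$-LDP randomized maps $Q_1,\dots,Q_n:[d]\to\mathcal Z$ and every (possibly randomized) estimator $\mathcal B:\mathcal Z^n\to[0,1]^d$ there is a probability distribution $P$ on $[d]$ such that, if $v_1,\dots,v_n$ are drawn i.i.d. from $P$, the reports $z_i=Q_i(v_i)$ are generated with independent randomness,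 and $\hat f=\mathcal B(z_1,\dots,z_n)$, then $$\mathbb E\Big[\max_{u\in[d]}|\hat f(u)-f(u)|\Big]\;\ge\; c\,\min\!\left(\frac1\varepsilon\sqrt{\frac{\log d}{n}},\,1\right).$$ -/

import Mathlib

open MeasureTheory ProbabilityTheory

noncomputable section

/-- `(ε, δ)`-local differential privacy of a randomized map `Q` from the items `{0, …, d - 1}` to
reports in `Z`: `Pr[Q(v) ∈ S] ≤ e^ε Pr[Q(v') ∈ S] + δ` for all items `v, v'` and measurable `S`. -/
def IsLDP {d : ℕ} {Z : Type*} [MeasurableSpace Z] (ε δ : ℝ) (Q : Kernel (Fin d) Z) : Prop :=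
  ∀ v v' : Fin d, ∀ S : Set Z, MeasurableSet S →
    (Q v).real S ≤ Real.exp ε * (Q v').real S + δ

/-- The empirical frequency vector `f(u) = #{i : v i = u} / n` of the items `v 0, …, v (n - 1)`. -/
def freq {n d : ℕ} (v : Fin n → Fin d) : Fin d → ℝ :=
  fun u => ((Finset.univ.filter fun i => v i = u).card : ℝ) / n

/-- The error `max_u |g(u) - f(u)|` of an estimate `g ∈ [0,1]^d` of the frequency vector `f`
(the norm on `Fin d → ℝ` is the sup norm). -/
def linfError {d : ℕ} (f : Fin d → ℝ) (g : Fin d → Set.Icc (0 : ℝ) 1) : ℝ :=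
  ‖(fun u => (g u : ℝ)) - f‖

/-- The expected error of the (possibly randomized) estimator `B` when the items `v i` are i.i.d.
with law `P`, the reports are generated independently, the `i`-th one by `Q i` applied to `v i`, and
`B` is applied to the reports. -/
def expectedError {n d : ℕ} {Z : Type*} [MeasurableSpace Z] (P : Measure (Fin d))
    (Q : Fin n → Kernel (Fin d) Z) (B : Kernel (Fin n → Z) (Fin d → Set.Icc (0 : ℝ) 1)) : ℝ :=
  ∫ v, ∫ z, ∫ g, linfError (freq v) g ∂(B z)
    ∂(Measure.pi fun i => Q i (v i)) ∂(Measure.pi fun _ : Fin n => P)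

end

/-!
Each user's law given item `v` has, up to mass `δ`, a density with respect to the law given a base
item `x₀`, with second moment at most `1 + χ`, where `χ = 2 (cosh ε - 1) + δ` is of order `ε² + δ`:
truncate the Radon–Nikodym derivative at `e ^ ε`. If every user holds `u` with probability `η` and
`x₀` otherwise, then `χ` shrinks to `η² χ`: the density minus `1` has mean at most `0` and is
scaled by `η`. Both bounds tensorize over the users, so by Cauchy–Schwarz an event `D` has
probability at most `n η δ + √((1 + η² χ) ^ n * Pr₀ D)`, where `Pr₀ D` is its probability when all
items are `x₀`.

An estimator with error below `η / 4` decodes `u` by thresholding. The decoding events of the `d`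
items are disjoint, so one of them has `Pr₀ D ≤ 1 / d`; for `η` of order `min (√(log d / n) / ε) 1`
this `u` is decoded with probability bounded away from `1`. The number of users holding `u`
concentrates only if `n η` is large. When it is not, `n` is bounded in terms of `C`, and the point
masses at two items cannot be told apart reliably.
-/

open scoped ENNReal unitInterval Function

section ProductMeasure

variable {ι : Type*} [Fintype ι] {Z : ι → Type*} [∀ i, MeasurableSpace (Z i)]

theorem ae_pi_forall (μ : ∀ i, Measure (Z i)) [∀ i, SigmaFinite (μ i)] {p : ∀ i, Z i → Prop}
    (h : ∀ i, ∀ᵐ x ∂μ i, p i x) : ∀ᵐ z ∂Measure.pi μ, ∀ i, p i (z i) :=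
  ae_all_iff.2 fun i => (Measure.quasiMeasurePreserving_eval μ i).ae (h i)

theorem lintegral_prod_eval_pi (μ : ∀ i, Measure (Z i)) [∀ i, IsProbabilityMeasure (μ i)]
    {f : ∀ i, Z i → ℝ≥0∞} (hf : ∀ i, Measurable (f i)) :
    ∫⁻ z, ∏ i, f i (z i) ∂Measure.pi μ = ∏ i, ∫⁻ x, f i x ∂μ i := by
  refine (lintegral_prod_eq_prod_lintegral_of_indepFun Finset.univ
    (fun i (z : ∀ i, Z i) => f i (z i))
    (iIndepFun_pi fun i => (hf i).aemeasurable)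
    fun i => (hf i).comp (measurable_pi_apply i)).trans ?_
  exact Finset.prod_congr rfl fun i _ => (measurePreserving_eval μ i).lintegral_comp (hf i)

theorem measurePi_mono {μ ν : ∀ i, Measure (Z i)} (h : ∀ i, μ i ≤ ν i) :
    Measure.pi μ ≤ Measure.pi ν := by
  refine Measure.le_iff.2 fun S hS => ?_
  rw [Measure.pi, Measure.pi, toMeasure_apply _ _ hS, toMeasure_apply _ _ hS]
  refine OuterMeasure.le_pi.2 (fun s _ => ?_) S
  exact (OuterMeasure.pi_pi_le _ s).trans (Finset.prod_le_prod' fun i _ => h i (s i))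

theorem withDensity_prod_eval_pi (μ : ∀ i, Measure (Z i)) [∀ i, IsProbabilityMeasure (μ i)]
    {s : ∀ i, Z i → ℝ≥0∞} (hs : ∀ i, Measurable (s i))
    [∀ i, IsFiniteMeasure ((μ i).withDensity (s i))] :
    (Measure.pi μ).withDensity (fun z => ∏ i, s i (z i)) =
      Measure.pi fun i => (μ i).withDensity (s i) := by
  refine (Measure.pi_eq fun E hE => ?_).symm
  have hbox (z : ∀ i, Z i) : (Set.univ.pi E).indicator (fun z => ∏ i, s i (z i)) z =
      ∏ i, (E i).indicator (s i) (z i) := by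
    by_cases hz : z ∈ Set.univ.pi E
    · simp [hz, Set.mem_univ_pi.1 hz]
    · obtain ⟨i, hi⟩ : ∃ i, z i ∉ E i := by simpa [Set.mem_univ_pi] using hz
      rw [Set.indicator_of_notMem hz, Finset.prod_eq_zero (Finset.mem_univ i)]
      exact Set.indicator_of_notMem hi _
  rw [withDensity_apply _ (MeasurableSet.univ_pi hE),
    ← lintegral_indicator (MeasurableSet.univ_pi hE), lintegral_congr hbox,
    lintegral_prod_eval_pi μ fun i => (hs i).indicator (hE i)]
  exact Finset.prod_congr rfl fun i _ => by
    rw [lintegral_indicator (hE i), withDensity_apply _ (hE i)]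

end ProductMeasure

section TruncatedDensity

variable {Z W : Type*} [MeasurableSpace Z] [MeasurableSpace W] {μ ν : Measure Z}

/-- Up to mass `τ`, the measure `ν` has a density with respect to `μ` whose second moment is at
most `K`. Discarding mass is what makes second moments available for approximate (`δ > 0`)
differential privacy, where `ν` need not be absolutely continuous with respect to `μ`. -/
def HasTruncatedDensity (μ ν : Measure Z) (τ K : ℝ≥0∞) : Prop :=
  ∃ s : Z → ℝ≥0∞, Measurable s ∧ μ.withDensity s ≤ ν ∧ ν Set.univ ≤ τ + ∫⁻ z, s z ∂μ ∧
    ∫⁻ z, s z ^ 2 ∂μ ≤ K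

theorem exists_measure_eq_setLIntegral_rnDeriv (μ ν : Measure Z)
    [ν.HaveLebesgueDecomposition μ] :
    ∃ A, MeasurableSet A ∧ (∀ᵐ z ∂μ, z ∈ A) ∧
      ∀ E ⊆ A, MeasurableSet E → ν E = ∫⁻ z in E, ν.rnDeriv μ z ∂μ := by
  obtain ⟨A, hA, hsA, hμA⟩ := Measure.mutuallySingular_singularPart ν μ
  refine ⟨A, hA, hμA, fun E hEA hE => ?_⟩
  conv_lhs => rw [← Measure.singularPart_add_rnDeriv ν μ]
  rw [Measure.add_apply, measure_mono_null hEA hsA, zero_add, withDensity_apply _ hE]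

theorem measure_univ_le_add_lintegral_min_rnDeriv [ν.HaveLebesgueDecomposition μ] {a δ : ℝ≥0∞}
    (h : ∀ S, MeasurableSet S → ν S ≤ a * μ S + δ) :
    ν Set.univ ≤ δ + ∫⁻ z, min (ν.rnDeriv μ z) a ∂μ := by
  obtain ⟨A, hA, hμA, hνA⟩ := exists_measure_eq_setLIntegral_rnDeriv μ ν
  set S := {z | z ∈ A → a ≤ ν.rnDeriv μ z}
  have hS : MeasurableSet S := hA.imp (measurableSet_le measurable_const (by fun_prop))
  have hνS : ν S ≤ δ + ∫⁻ z in S, min (ν.rnDeriv μ z) a ∂μ := by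
    have hmin : ∀ᵐ z ∂μ, z ∈ S → a = min (ν.rnDeriv μ z) a := by
      filter_upwards [hμA] with z hz hzS
      exact (min_eq_right (hzS hz)).symm
    rw [← setLIntegral_congr_fun_ae hS hmin, setLIntegral_const, add_comm]
    exact h S hS
  have hνSc : ν Sᶜ = ∫⁻ z in Sᶜ, min (ν.rnDeriv μ z) a ∂μ := by
    have hlt : ∀ z ∈ Sᶜ, z ∈ A ∧ ν.rnDeriv μ z < a := fun z hz => by simpa [S] using hz
    rw [hνA _ (fun z hz => (hlt z hz).1) hS.compl]
    exact setLIntegral_congr_fun hS.compl fun z hz => (min_eq_left (hlt z hz).2.le).symm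
  calc ν Set.univ = ν S + ν Sᶜ := (measure_add_measure_compl hS).symm
    _ ≤ δ + ∫⁻ z in S, min (ν.rnDeriv μ z) a ∂μ + ∫⁻ z in Sᶜ, min (ν.rnDeriv μ z) a ∂μ := by
      rw [hνSc]; gcongr
    _ = δ + ∫⁻ z, min (ν.rnDeriv μ z) a ∂μ := by rw [add_assoc, lintegral_add_compl _ hS]

theorem lintegral_one_sub_mul_rnDeriv_le [IsFiniteMeasure μ] [ν.HaveLebesgueDecomposition μ]
    {a δ : ℝ≥0∞} (h : ∀ S, MeasurableSet S → μ S ≤ a * ν S + δ) :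
    ∫⁻ z, (1 - a * ν.rnDeriv μ z) ∂μ ≤ δ := by
  obtain ⟨A, hA, hμA, hνA⟩ := exists_measure_eq_setLIntegral_rnDeriv μ ν
  have hr : Measurable fun z => a * ν.rnDeriv μ z := by fun_prop
  set T := A ∩ {z | a * ν.rnDeriv μ z < 1}
  have hT : MeasurableSet T := hA.inter (measurableSet_lt hr measurable_const)
  have hsupp : ∫⁻ z, (1 - a * ν.rnDeriv μ z) ∂μ = ∫⁻ z in T, (1 - a * ν.rnDeriv μ z) ∂μ := by
    rw [← lintegral_indicator hT]
    refine lintegral_congr_ae ?_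
    filter_upwards [hμA] with z hz
    by_cases hzT : z ∈ T
    · rw [Set.indicator_of_mem hzT]
    · rw [Set.indicator_of_notMem hzT]
      exact tsub_eq_zero_of_le (not_lt.1 fun hlt => hzT ⟨hz, hlt⟩)
  have hsplit : ∫⁻ z in T, (1 - a * ν.rnDeriv μ z) ∂μ + ∫⁻ z in T, a * ν.rnDeriv μ z ∂μ = μ T := by
    rw [← lintegral_add_right _ hr, ← setLIntegral_one]
    exact setLIntegral_congr_fun hT fun z hz => tsub_add_cancel_of_le hz.2.le
  have hfin : ∫⁻ z in T, a * ν.rnDeriv μ z ∂μ ≠ ∞ :=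
    ne_top_of_le_ne_top (measure_ne_top μ T) (hsplit ▸ le_add_self)
  rw [hsupp, ← ENNReal.add_le_add_iff_right hfin, hsplit,
    lintegral_const_mul _ (by fun_prop), ← hνA T Set.inter_subset_left hT, add_comm]
  exact h T hT

/- For `x` in `[a⁻¹, a]` this is `(x - a⁻¹) * (x - a) ≤ 0`; the truncated subtraction pays for
smaller `x`. -/
theorem min_sq_add_one_le {a : ℝ≥0∞} (ha₀ : a ≠ 0) (ha : a ≠ ∞) (x : ℝ≥0∞) :
    min x a ^ 2 + 1 ≤ (a + a⁻¹) * min x a + (1 - a * x) := by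
  have hinv : a⁻¹ * a = 1 := ENNReal.inv_mul_cancel ha₀ ha
  rcases le_total a x with hax | hxa
  · rw [min_eq_right hax, add_mul, hinv, sq]
    exact le_self_add
  rw [min_eq_left hxa, sq]
  rcases le_total (a * x) 1 with h | h
  · calc x * x + 1 = x * x + a * x + (1 - a * x) := by rw [add_assoc, add_tsub_cancel_of_le h]
      _ ≤ a⁻¹ * x + a * x + (1 - a * x) := by
        gcongr
        rwa [ENNReal.le_inv_iff_mul_le, mul_comm]
      _ = (a + a⁻¹) * x + (1 - a * x) := by ring
  · obtain ⟨w, hw⟩ := exists_add_of_le hxa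
    calc x * x + 1 = x * x + a⁻¹ * w + a⁻¹ * x := by
          rw [← hinv]; nth_rw 2 [hw]; ring
      _ ≤ x * x + x * w + a⁻¹ * x := by
        gcongr
        rwa [ENNReal.inv_le_iff_le_mul (fun _ => ha₀) (fun h => absurd h ha)]
      _ = (x + w) * x + a⁻¹ * x := by ring
      _ = (a + a⁻¹) * x := by rw [← hw, add_mul]
      _ ≤ (a + a⁻¹) * x + (1 - a * x) := le_self_add

theorem hasTruncatedDensity_of_measure_le [IsProbabilityMeasure μ] [IsProbabilityMeasure ν]
    {a δ K : ℝ≥0∞} (ha₀ : a ≠ 0) (ha : a ≠ ∞) (hK : a + a⁻¹ + δ ≤ K + 1)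
    (hνμ : ∀ S, MeasurableSet S → ν S ≤ a * μ S + δ)
    (hμν : ∀ S, MeasurableSet S → μ S ≤ a * ν S + δ) :
    HasTruncatedDensity μ ν δ K := by
  set t : Z → ℝ≥0∞ := fun z => min (ν.rnDeriv μ z) a
  have ht : Measurable t := by fun_prop
  have htle : μ.withDensity t ≤ ν :=
    (withDensity_mono (ae_of_all μ fun z => min_le_left _ _)).trans
      (Measure.withDensity_rnDeriv_le ν μ)
  have ht1 : ∫⁻ z, t z ∂μ ≤ 1 := by
    simpa [withDensity_apply] using htle Set.univ
  refine ⟨t, ht, htle, measure_univ_le_add_lintegral_min_rnDeriv hνμ, ?_⟩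
  rw [← ENNReal.add_le_add_iff_right ENNReal.one_ne_top]
  calc ∫⁻ z, t z ^ 2 ∂μ + 1 = ∫⁻ z, (t z ^ 2 + 1) ∂μ := by
        rw [lintegral_add_right _ measurable_const, lintegral_one, measure_univ]
    _ ≤ ∫⁻ z, ((a + a⁻¹) * t z + (1 - a * ν.rnDeriv μ z)) ∂μ :=
        lintegral_mono fun z => min_sq_add_one_le ha₀ ha _
    _ = (a + a⁻¹) * ∫⁻ z, t z ∂μ + ∫⁻ z, (1 - a * ν.rnDeriv μ z) ∂μ := by
        rw [lintegral_add_left (by fun_prop), lintegral_const_mul _ ht]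
    _ ≤ (a + a⁻¹) * 1 + δ := by
        gcongr
        exact lintegral_one_sub_mul_rnDeriv_le hμν
    _ ≤ K + 1 := by rwa [mul_one]

theorem HasTruncatedDensity.mixture [IsProbabilityMeasure μ] [IsProbabilityMeasure ν]
    {τ χ p q : ℝ≥0∞} (h : HasTruncatedDensity μ ν τ (1 + χ)) (hpq : p + q = 1) :
    HasTruncatedDensity μ (p • μ + q • ν) (q * τ) (1 + q ^ 2 * χ) := by
  obtain ⟨s, hs, hsν, hτ, hK⟩ := h
  have hs1 : ∫⁻ z, s z ∂μ ≤ 1 := by simpa [withDensity_apply] using hsν Set.univ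
  have hqs : Measurable (q • s) := hs.const_smul q
  refine ⟨(fun _ => p) + q • s, measurable_const.add hqs, ?_, ?_, ?_⟩
  · rw [withDensity_add_left measurable_const, withDensity_const, withDensity_smul _ hs]
    gcongr
  · calc (p • μ + q • ν) Set.univ = p + q * ν Set.univ := by simp
      _ ≤ p + q * (τ + ∫⁻ z, s z ∂μ) := by gcongr
      _ = q * τ + ∫⁻ z, (p + q * s z) ∂μ := by
        rw [lintegral_add_left measurable_const, lintegral_const_mul _ hs, lintegral_const,
          measure_univ]
        ring
  · calc ∫⁻ z, (p + q * s z) ^ 2 ∂μ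
        = ∫⁻ z, (p ^ 2 + (2 * p * q * s z + q ^ 2 * s z ^ 2)) ∂μ := by
          congr with z; ring
      _ = p ^ 2 + (2 * p * q * ∫⁻ z, s z ∂μ + q ^ 2 * ∫⁻ z, s z ^ 2 ∂μ) := by
          rw [lintegral_add_left measurable_const, lintegral_add_left (by fun_prop),
            lintegral_const_mul _ hs, lintegral_const_mul _ (hs.pow_const 2), lintegral_const,
            measure_univ, mul_one]
      _ ≤ p ^ 2 + (2 * p * q * 1 + q ^ 2 * (1 + χ)) := by gcongr
      _ = (p + q) ^ 2 + q ^ 2 * χ := by ring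
      _ = 1 + q ^ 2 * χ := by rw [hpq, one_pow]

theorem one_le_sum_add_prod {ι : Type*} (t : Finset ι) {τ x : ι → ℝ≥0∞} (hx : ∀ i, x i ≤ 1)
    (h : ∀ i, 1 ≤ τ i + x i) : 1 ≤ ∑ i ∈ t, τ i + ∏ i ∈ t, x i := by
  classical
  induction t using Finset.induction_on with
  | empty => simp
  | insert i t hi ih =>
    rw [Finset.sum_insert hi, Finset.prod_insert hi]
    calc 1 ≤ τ i + x i * 1 := by rw [mul_one]; exact h i
      _ ≤ τ i + x i * (∑ j ∈ t, τ j + ∏ j ∈ t, x j) := by gcongr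
      _ = τ i + (x i * ∑ j ∈ t, τ j + x i * ∏ j ∈ t, x j) := by rw [mul_add]
      _ ≤ τ i + (1 * ∑ j ∈ t, τ j + x i * ∏ j ∈ t, x j) := by gcongr; exact hx i
      _ = τ i + ∑ j ∈ t, τ j + x i * ∏ j ∈ t, x j := by rw [one_mul, add_assoc]

theorem HasTruncatedDensity.pi {ι : Type*} [Fintype ι] {Z : ι → Type*} [∀ i, MeasurableSpace (Z i)]
    {μ ν : ∀ i, Measure (Z i)} [∀ i, IsProbabilityMeasure (μ i)] [∀ i, IsProbabilityMeasure (ν i)]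
    {τ K : ι → ℝ≥0∞} (h : ∀ i, HasTruncatedDensity (μ i) (ν i) (τ i) (K i)) :
    HasTruncatedDensity (Measure.pi μ) (Measure.pi ν) (∑ i, τ i) (∏ i, K i) := by
  choose s hs hsν hτ hK using h
  have (i : ι) : IsFiniteMeasure ((μ i).withDensity (s i)) := isFiniteMeasure_of_le (ν i) (hsν i)
  refine ⟨fun z => ∏ i, s i (z i), by fun_prop, ?_, ?_, ?_⟩
  · rw [withDensity_prod_eval_pi μ hs]
    exact measurePi_mono hsν
  · rw [measure_univ, lintegral_prod_eval_pi μ hs]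
    refine one_le_sum_add_prod _ (fun i => ?_) fun i => ?_
    · simpa [withDensity_apply] using hsν i Set.univ
    · simpa using hτ i
  · simp only [← Finset.prod_pow]
    rw [lintegral_prod_eval_pi μ fun i => (hs i).pow_const 2]
    exact Finset.prod_le_prod' fun i _ => hK i

theorem sq_lintegral_mul_le (μ : Measure Z) {f g : Z → ℝ≥0∞} (hf : Measurable f)
    (hg : Measurable g) :
    (∫⁻ z, f z * g z ∂μ) ^ 2 ≤ (∫⁻ z, f z ^ 2 ∂μ) * ∫⁻ z, g z ^ 2 ∂μ := by
  have h := ENNReal.lintegral_mul_le_Lp_mul_Lq μ Real.HolderConjugate.two_two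
    hf.aemeasurable hg.aemeasurable
  rw [← ENNReal.mul_rpow_of_nonneg _ _ (by positivity), one_div,
    ENNReal.le_rpow_inv_iff two_pos] at h
  simpa only [Pi.mul_apply, ENNReal.rpow_two] using h

theorem HasTruncatedDensity.lintegral_le [IsFiniteMeasure ν] {τ K : ℝ≥0∞}
    (h : HasTruncatedDensity μ ν τ K) {φ : Z → ℝ≥0∞} (hφ : Measurable φ) (hφ1 : ∀ z, φ z ≤ 1) :
    ∫⁻ z, φ z ∂ν ≤ τ + (K * ∫⁻ z, φ z ∂μ) ^ (1 / 2 : ℝ) := by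
  obtain ⟨s, hs, hsν, hτ, hK⟩ := h
  have := isFiniteMeasure_of_le ν hsν
  have hrest : (ν - μ.withDensity s) Set.univ ≤ τ := by
    rw [Measure.sub_apply .univ hsν, withDensity_apply _ .univ, setLIntegral_univ]
    exact tsub_le_iff_right.2 hτ
  have hmain : ∫⁻ z, s z * φ z ∂μ ≤ (K * ∫⁻ z, φ z ∂μ) ^ (1 / 2 : ℝ) := by
    rw [one_div, ENNReal.le_rpow_inv_iff two_pos, ENNReal.rpow_two]
    refine (sq_lintegral_mul_le μ hs hφ).trans ?_
    gcongr with z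
    exact pow_le_of_le_one zero_le (hφ1 z) two_ne_zero
  calc ∫⁻ z, φ z ∂ν
      = ∫⁻ z, φ z ∂(ν - μ.withDensity s) + ∫⁻ z, φ z ∂μ.withDensity s := by
        rw [← lintegral_add_measure, Measure.sub_add_cancel_of_le hsν]
    _ ≤ ∫⁻ _, 1 ∂(ν - μ.withDensity s) + ∫⁻ z, s z * φ z ∂μ := by
        rw [lintegral_withDensity_eq_lintegral_mul μ hs hφ]
        gcongr with z
        · exact hφ1 z
        · exact le_rfl
    _ ≤ τ + (K * ∫⁻ z, φ z ∂μ) ^ (1 / 2 : ℝ) := by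
        rw [lintegral_one]
        gcongr

theorem HasTruncatedDensity.measureReal_bind_le [IsProbabilityMeasure μ] [IsProbabilityMeasure ν]
    {τ K : ℝ} (hτ : 0 ≤ τ) (hK : 0 ≤ K) (h : HasTruncatedDensity μ ν (.ofReal τ) (.ofReal K))
    (B : Kernel Z W) [IsMarkovKernel B] {D : Set W} (hD : MeasurableSet D) :
    (B ∘ₘ ν).real D ≤ τ + √(K * (B ∘ₘ μ).real D) := by
  have hle := h.lintegral_le (B.measurable_coe hD) fun z => prob_le_one
  rw [← Measure.bind_apply hD B.aemeasurable, ← Measure.bind_apply hD B.aemeasurable] at hle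
  refine ENNReal.toReal_le_of_le_ofReal (by positivity) (hle.trans_eq ?_)
  rw [ENNReal.ofReal_add hτ (Real.sqrt_nonneg _), Real.sqrt_eq_rpow,
    ← ENNReal.ofReal_rpow_of_nonneg (by positivity) (by positivity), ENNReal.ofReal_mul hK,
    ofReal_measureReal]

end TruncatedDensity

section LocalPrivacy

variable {d : ℕ} {Z : Type*} [MeasurableSpace Z] {ε δ : ℝ} {Q : Kernel (Fin d) Z}

theorem IsLDP.nonneg (h : IsLDP ε δ Q) (v : Fin d) : 0 ≤ δ := by
  simpa using h v v ∅ .empty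

theorem IsLDP.hasTruncatedDensity [IsMarkovKernel Q] (h : IsLDP ε δ Q) (v v' : Fin d) :
    HasTruncatedDensity (Q v) (Q v') (.ofReal δ)
      (1 + .ofReal (2 * (Real.cosh ε - 1) + δ)) := by
  have hδ := h.nonneg v
  have happrox (w w' : Fin d) (S : Set Z) (hS : MeasurableSet S) :
      Q w S ≤ .ofReal (Real.exp ε) * Q w' S + .ofReal δ := by
    rw [← ofReal_measureReal, ← ofReal_measureReal (μ := Q w'),
      ← ENNReal.ofReal_mul (Real.exp_pos ε).le, ← ENNReal.ofReal_add (by positivity) hδ]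
    exact ENNReal.ofReal_le_ofReal (h w w' S hS)
  refine hasTruncatedDensity_of_measure_le (by simp [Real.exp_pos]) ENNReal.ofReal_ne_top ?_
    (happrox v' v) (happrox v v')
  have hχ : 0 ≤ 2 * (Real.cosh ε - 1) + δ := by linarith [Real.one_le_cosh ε]
  rw [← ENNReal.ofReal_inv_of_pos (Real.exp_pos ε), ← ENNReal.ofReal_one,
    ← ENNReal.ofReal_add (by positivity) (by positivity),
    ← ENNReal.ofReal_add (by positivity) hδ, ← ENNReal.ofReal_add zero_le_one hχ,
    ← ENNReal.ofReal_add (by positivity) zero_le_one, Real.cosh_eq, Real.exp_neg]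
  exact ENNReal.ofReal_le_ofReal (by linarith)

end LocalPrivacy

section Frequency

variable {n d : ℕ}

theorem freq_nonneg (v : Fin n → Fin d) (u : Fin d) : 0 ≤ freq v u := by
  unfold freq; positivity

theorem freq_le_one (v : Fin n → Fin d) (u : Fin d) : freq v u ≤ 1 := by
  refine div_le_one_of_le₀ ?_ n.cast_nonneg
  exact_mod_cast (Finset.card_filter_le _ _).trans_eq (Finset.card_fin n)

theorem freq_eq_zero {v : Fin n → Fin d} {u : Fin d} (h : ∀ i, v i ≠ u) : freq v u = 0 := by
  simp [freq, h]

theorem freq_eq_one (hn : n ≠ 0) {v : Fin n → Fin d} {u : Fin d} (h : ∀ i, v i = u) :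
    freq v u = 1 := by
  simp [freq, h, hn]

theorem abs_sub_le_linfError (f : Fin d → ℝ) (g : Fin d → I) (u : Fin d) :
    |(g u : ℝ) - f u| ≤ linfError f g :=
  norm_le_pi_norm ((fun u => (g u : ℝ)) - f) u

theorem linfError_nonneg (f : Fin d → ℝ) (g : Fin d → I) : 0 ≤ linfError f g :=
  norm_nonneg _

theorem linfError_freq_le_one (v : Fin n → Fin d) (g : Fin d → I) : linfError (freq v) g ≤ 1 := by
  refine (pi_norm_le_iff_of_nonneg zero_le_one).2 fun u => abs_le.2 ⟨?_, ?_⟩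
  · linarith [(g u).2.1, freq_le_one v u, Pi.sub_apply (fun u => (g u : ℝ)) (freq v) u]
  · linarith [(g u).2.2, freq_nonneg v u, Pi.sub_apply (fun u => (g u : ℝ)) (freq v) u]

end Frequency

section Model

variable {n d : ℕ} {Z : Type*} [MeasurableSpace Z]

theorem expectedError_nonneg (P : Measure (Fin d)) (Q : Fin n → Kernel (Fin d) Z)
    (B : Kernel (Fin n → Z) (Fin d → I)) : 0 ≤ expectedError P Q B :=
  integral_nonneg fun _ => integral_nonneg fun _ => integral_nonneg fun _ => linfError_nonneg _ _

/-- The reports of all `n` users, as a single randomized map of the vector of their items. -/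
noncomputable def reportKernel (Q : Fin n → Kernel (Fin d) Z) :
    Kernel (Fin n → Fin d) (Fin n → Z) where
  toFun v := Measure.pi fun i => Q i (v i)
  measurable' := measurable_of_finite _

/-- The joint law of the items and the estimate, when the items are i.i.d. with law `P`. -/
noncomputable def jointLaw (P : Measure (Fin d)) (Q : Fin n → Kernel (Fin d) Z)
    (B : Kernel (Fin n → Z) (Fin d → I)) : Measure ((Fin n → Fin d) × (Fin d → I)) :=
  (Measure.pi fun _ => P) ⊗ₘ (B ∘ₖ reportKernel Q)

variable (P : Measure (Fin d)) [IsProbabilityMeasure P] (Q : Fin n → Kernel (Fin d) Z)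
  [∀ i, IsMarkovKernel (Q i)] (B : Kernel (Fin n → Z) (Fin d → I)) [IsMarkovKernel B]

instance : IsMarkovKernel (reportKernel Q) :=
  ⟨fun v => inferInstanceAs (IsProbabilityMeasure (Measure.pi fun i => Q i (v i)))⟩

instance : IsProbabilityMeasure (jointLaw P Q B) := by
  unfold jointLaw; infer_instance

theorem reportKernel_comp_pi :
    reportKernel Q ∘ₘ (Measure.pi fun _ => P) = Measure.pi fun i => Q i ∘ₘ P := by
  refine (Measure.pi_eq fun E hE => ?_).symm
  rw [Measure.bind_apply (MeasurableSet.univ_pi hE) (reportKernel Q).aemeasurable]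
  calc ∫⁻ v, reportKernel Q v (Set.univ.pi E) ∂(Measure.pi fun _ => P)
      = ∫⁻ v, ∏ i, Q i (v i) (E i) ∂(Measure.pi fun _ => P) :=
        lintegral_congr fun v => Measure.pi_pi _ E
    _ = ∏ i, ∫⁻ x, Q i x (E i) ∂P :=
        lintegral_prod_eval_pi _ fun i => (Q i).measurable_coe (hE i)
    _ = ∏ i, (Q i ∘ₘ P) (E i) :=
        Finset.prod_congr rfl fun i _ => (Measure.bind_apply (hE i) (Q i).aemeasurable).symm

theorem snd_jointLaw : (jointLaw P Q B).snd = B ∘ₘ Measure.pi fun i => Q i ∘ₘ P := by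
  rw [jointLaw, Measure.snd_compProd, ← Measure.comp_assoc, reportKernel_comp_pi]

theorem measurable_linfError_freq :
    Measurable fun x : (Fin n → Fin d) × (Fin d → I) => linfError (freq x.1) x.2 := by
  refine measurable_from_prod_countable_right fun v => ?_
  unfold linfError
  fun_prop

theorem integrable_linfError_freq :
    Integrable (fun x => linfError (freq x.1) x.2) (jointLaw P Q B) := by
  refine .of_bound measurable_linfError_freq.aestronglyMeasurable 1 (ae_of_all _ fun x => ?_)
  rw [Real.norm_of_nonneg (linfError_nonneg _ _)]
  exact linfError_freq_le_one x.1 x.2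

theorem expectedError_eq_integral_jointLaw :
    expectedError P Q B = ∫ x, linfError (freq x.1) x.2 ∂jointLaw P Q B := by
  have hint := integrable_linfError_freq P Q B
  rw [jointLaw, Measure.integral_compProd hint]
  refine integral_congr_ae ?_
  filter_upwards [((Measure.integrable_compProd_iff hint.aestronglyMeasurable).1 hint).1] with v hv
  exact (Kernel.integral_comp hv).symm

end Model

section Decoding

variable {n d : ℕ} {Z : Type*} [MeasurableSpace Z] {x₀ u : Fin d} {θ : ℝ}

/-- The estimates in which, among all items other than the base item `x₀`, exactly `u` is reported
with frequency at least `θ` (for `u = x₀`, none is). Thresholding an accurate estimate thus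
decodes `u` from users whose items are all `x₀` or `u`. -/
def decodeSet (x₀ : Fin d) (θ : ℝ) (u : Fin d) : Set (Fin d → I) :=
  {g | ∀ w, w ≠ x₀ → (θ ≤ g w ↔ w = u)}

theorem measurableSet_decodeSet (x₀ : Fin d) (θ : ℝ) (u : Fin d) :
    MeasurableSet (decodeSet x₀ θ u) := by
  have h (w : Fin d) : MeasurableSet {g : Fin d → I | θ ≤ g w} :=
    measurableSet_le measurable_const (measurable_subtype_coe.comp (measurable_pi_apply w))
  unfold decodeSet
  measurability

theorem pairwise_disjoint_decodeSet (x₀ : Fin d) (θ : ℝ) :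
    Pairwise (Disjoint on decodeSet x₀ θ) := by
  refine fun u u' huu' => Set.disjoint_left.2 fun g hg hg' => huu' ?_
  by_cases hu : u = x₀
  · have hu' : u' ≠ x₀ := fun h => huu' (hu.trans h.symm)
    exact ((hg u' hu').1 ((hg' u' hu').2 rfl)).symm
  · exact (hg' u hu).1 ((hg u hu).2 rfl)

theorem le_linfError_of_notMem_decodeSet {v : Fin n → Fin d} {g : Fin d → I}
    (hv : ∀ i, v i = x₀ ∨ v i = u) (hθ : 2 * θ ≤ freq v u) (hg : g ∉ decodeSet x₀ θ u) :
    θ ≤ linfError (freq v) g := by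
  obtain ⟨w, hw, hwu⟩ : ∃ w, w ≠ x₀ ∧ ¬(θ ≤ g w ↔ w = u) := by
    simpa only [decodeSet, Set.mem_ofPred_eq, not_forall, exists_prop] using hg
  refine le_trans ?_ (abs_sub_le_linfError (freq v) g w)
  by_cases hwu' : w = u
  · have hlt : (g w : ℝ) < θ := by simpa [hwu'] using hwu
    rw [abs_sub_comm, hwu'] at *
    exact le_trans (by linarith) (le_abs_self _)
  · have hle : θ ≤ g w := by simpa [hwu'] using hwu
    have hfreq : freq v w = 0 := freq_eq_zero fun i => by
      rcases hv i with h | h <;> rw [h]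
      exacts [hw.symm, Ne.symm hwu']
    rw [hfreq, sub_zero]
    exact hle.trans (le_abs_self _)

theorem ae_jointLaw_items {p : Fin d → Prop} (P : Measure (Fin d)) [IsProbabilityMeasure P]
    (hP : ∀ᵐ x ∂P, p x) (Q : Fin n → Kernel (Fin d) Z) [∀ i, IsMarkovKernel (Q i)]
    (B : Kernel (Fin n → Z) (Fin d → I)) [IsMarkovKernel B] :
    ∀ᵐ x ∂jointLaw P Q B, ∀ i, p (x.1 i) :=
  Measure.ae_compProd_of_ae_fst _ (Set.toFinite _).measurableSet (ae_pi_forall _ fun _ => hP)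

theorem one_le_expectedError_div_add (P : Measure (Fin d)) [IsProbabilityMeasure P]
    (hP : ∀ᵐ x ∂P, x = x₀ ∨ x = u) (Q : Fin n → Kernel (Fin d) Z) [∀ i, IsMarkovKernel (Q i)]
    (B : Kernel (Fin n → Z) (Fin d → I)) [IsMarkovKernel B] (hθ : 0 < θ) :
    1 ≤ expectedError P Q B / θ +
      (B ∘ₘ Measure.pi fun i => Q i ∘ₘ P).real (decodeSet x₀ θ u) +
      (Measure.pi fun _ : Fin n => P).real {v | freq v u < 2 * θ} := by
  set L := jointLaw P Q B
  let inaccurate := {x : (Fin n → Fin d) × (Fin d → I) | θ ≤ linfError (freq x.1) x.2}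
  let decoded := {x : (Fin n → Fin d) × (Fin d → I) | x.2 ∈ decodeSet x₀ θ u}
  let rare := {x : (Fin n → Fin d) × (Fin d → I) | freq x.1 u < 2 * θ}
  have hinaccurate : L.real inaccurate ≤ expectedError P Q B / θ := by
    rw [le_div_iff₀' hθ, expectedError_eq_integral_jointLaw]
    exact mul_meas_ge_le_integral_of_nonneg (ae_of_all _ fun x => linfError_nonneg _ _)
      (integrable_linfError_freq P Q B) θ
  have hdecoded : L.real decoded =
      (B ∘ₘ Measure.pi fun i => Q i ∘ₘ P).real (decodeSet x₀ θ u) := by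
    rw [← snd_jointLaw, Measure.snd, map_measureReal_apply measurable_snd
      (measurableSet_decodeSet x₀ θ u)]
    rfl
  have hrare : L.real rare = (Measure.pi fun _ : Fin n => P).real {v | freq v u < 2 * θ} := by
    rw [← Measure.fst_compProd (Measure.pi fun _ => P) (B ∘ₖ reportKernel Q), Measure.fst,
      map_measureReal_apply measurable_fst (Set.toFinite _).measurableSet]
    rfl
  have hcover : ∀ᵐ x ∂L, x ∈ inaccurate ∪ decoded ∪ rare := by
    filter_upwards [ae_jointLaw_items P hP Q B] with x hx
    by_contra hx'
    obtain ⟨hacc, hfreq⟩ := not_or.1 hx'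
    obtain ⟨hacc, hdec⟩ := not_or.1 hacc
    exact hacc (le_linfError_of_notMem_decodeSet hx (not_lt.1 hfreq) hdec)
  calc 1 = L.real Set.univ := probReal_univ.symm
    _ = L.real (inaccurate ∪ decoded ∪ rare) :=
        measureReal_congr (Filter.eventuallyEq_univ.2 hcover).symm
    _ ≤ L.real inaccurate + L.real decoded + L.real rare :=
        (measureReal_union_le _ _).trans (by gcongr; exact measureReal_union_le _ _)
    _ ≤ _ := by rw [hdecoded, hrare]; gcongr

theorem exists_measureReal_le_inv_card {ι W : Type*} [Fintype ι] [Nonempty ι] [MeasurableSpace W]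
    (μ : Measure W) [IsProbabilityMeasure μ] {D : ι → Set W} (hD : ∀ i, MeasurableSet (D i))
    (hdisj : Pairwise (Disjoint on D)) : ∃ i, μ.real (D i) ≤ (Fintype.card ι : ℝ)⁻¹ := by
  have hsum : ∑ i, μ.real (D i) ≤ ∑ _i : ι, (Fintype.card ι : ℝ)⁻¹ := by
    rw [← measureReal_iUnion_fintype hdisj hD]
    simp
  obtain ⟨i, -, hi⟩ := Finset.exists_le_of_sum_le Finset.univ_nonempty hsum
  exact ⟨i, hi⟩

end Decoding

section RareItem

variable {n d : ℕ} (P : Measure (Fin d)) [IsProbabilityMeasure P]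

theorem integral_exp_neg_ite_eq_le (u : Fin d) :
    ∫ x, Real.exp (-if x = u then 1 else 0) ∂P ≤ Real.exp (-(3 / 5 * P.real {u})) := by
  have hsplit (x : Fin d) : Real.exp (-if x = u then 1 else 0) =
      1 - ({u} : Set (Fin d)).indicator (fun _ => 1 - Real.exp (-1)) x := by
    by_cases hx : x = u <;> simp [hx]
  have hexp : Real.exp (-1) < 2 / 5 := Real.exp_neg_one_lt_d9.trans (by norm_num)
  calc ∫ x, Real.exp (-if x = u then 1 else 0) ∂P
      = 1 - P.real {u} * (1 - Real.exp (-1)) := by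
        simp_rw [hsplit]
        rw [integral_sub (integrable_const _) .of_finite,
          integral_indicator_const _ (measurableSet_singleton u)]
        simp
    _ ≤ -(3 / 5 * P.real {u}) + 1 := by
        nlinarith [measureReal_nonneg (μ := P) (s := {u})]
    _ ≤ _ := Real.add_one_le_exp _

theorem measureReal_freq_le_le_exp (hn : n ≠ 0) {u : Fin d} {p : ℝ} (hp : p ≤ P.real {u}) :
    (Measure.pi fun _ : Fin n => P).real {v | freq v u ≤ p / 2} ≤ Real.exp (-(n * p / 10)) := by
  let count (v : Fin n → Fin d) : ℝ := ∑ i, if v i = u then 1 else 0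
  have hmgf : mgf count (Measure.pi fun _ => P) (-1) ≤ Real.exp (-(3 / 5 * p)) ^ n := by
    have hprod (v : Fin n → Fin d) :
        Real.exp (-1 * count v) = ∏ i, Real.exp (-if v i = u then 1 else 0) := by
      rw [neg_one_mul, ← Finset.sum_neg_distrib, Real.exp_sum]
    simp_rw [mgf, hprod]
    rw [integral_fintype_prod_eq_prod fun _ x => Real.exp (-if x = u then 1 else 0),
      Finset.prod_const, Finset.card_fin]
    gcongr
    exact (integral_exp_neg_ite_eq_le P u).trans (by gcongr)
  calc (Measure.pi fun _ : Fin n => P).real {v | freq v u ≤ p / 2}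
      = (Measure.pi fun _ : Fin n => P).real {v | count v ≤ n * (p / 2)} := by
        congr with v
        rw [freq, div_le_iff₀' (by positivity), Finset.natCast_card_filter]
    _ ≤ Real.exp (-(-1) * (n * (p / 2))) * Real.exp (-(3 / 5 * p)) ^ n :=
        (measure_le_le_exp_mul_mgf _ (neg_nonpos.2 zero_le_one) .of_finite).trans (by gcongr)
    _ = Real.exp (-(n * p / 10)) := by
        rw [← Real.exp_nat_mul, ← Real.exp_add]
        ring_nf

end RareItem

section SpikedLaw

variable {α : Type*} [MeasurableSpace α] (a b : α) (η : I)

/-- The law of an item equal to `b` with probability `η` and to the base item `a` otherwise: the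
family of priors, indexed by `b`, among which the estimator cannot distinguish. -/
noncomputable def spikedLaw : Measure α :=
  ENNReal.ofReal (1 - η) • Measure.dirac a + ENNReal.ofReal η • Measure.dirac b

theorem ofReal_one_sub_add_ofReal : ENNReal.ofReal (1 - η) + ENNReal.ofReal η = 1 := by
  rw [← ENNReal.ofReal_add (sub_nonneg.2 η.2.2) η.2.1, sub_add_cancel, ENNReal.ofReal_one]

instance : IsProbabilityMeasure (spikedLaw a b η) :=
  ⟨by simp [spikedLaw, ofReal_one_sub_add_ofReal]⟩

theorem ae_spikedLaw [MeasurableSingletonClass α] : ∀ᵐ x ∂spikedLaw a b η, x = a ∨ x = b := by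
  rw [spikedLaw, ae_add_measure_iff]
  exact ⟨Measure.ae_smul_measure (by simp [ae_dirac_eq]) _,
    Measure.ae_smul_measure (by simp [ae_dirac_eq]) _⟩

theorem le_measureReal_spikedLaw_singleton [MeasurableSingletonClass α] :
    (η : ℝ) ≤ (spikedLaw a b η).real {b} := by
  rw [measureReal_def, ← ENNReal.ofReal_le_iff_le_toReal (measure_ne_top _ _)]
  simp [spikedLaw]

theorem comp_spikedLaw {β : Type*} [MeasurableSpace β] (Q : Kernel α β) :
    Q ∘ₘ spikedLaw a b η = ENNReal.ofReal (1 - η) • Q a + ENNReal.ofReal η • Q b := by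
  rw [spikedLaw, Measure.comp_add, Measure.comp_smul, Measure.comp_smul,
    Measure.dirac_bind Q.measurable, Measure.dirac_bind Q.measurable]

end SpikedLaw

section LowerBounds

variable {n d : ℕ} {Z : Type*} [MeasurableSpace Z] {ε δ : ℝ} {Q : Fin n → Kernel (Fin d) Z}
  [∀ i, IsMarkovKernel (Q i)]

theorem hasTruncatedDensity_reports_spikedLaw (hn : n ≠ 0) (hQ : ∀ i, IsLDP ε δ (Q i))
    (x₀ u : Fin d) (η : I) :
    HasTruncatedDensity (Measure.pi fun i => Q i x₀)
      (Measure.pi fun i => Q i ∘ₘ spikedLaw x₀ u η) (.ofReal (n * (η * δ)))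
      (.ofReal ((1 + η ^ 2 * (2 * (Real.cosh ε - 1) + δ)) ^ n)) := by
  have hχ : 0 ≤ 2 * (Real.cosh ε - 1) + δ := by
    linarith [Real.one_le_cosh ε, (hQ ⟨0, Nat.pos_of_ne_zero hn⟩).nonneg x₀]
  have h (i : Fin n) : HasTruncatedDensity (Q i x₀) (Q i ∘ₘ spikedLaw x₀ u η)
      (.ofReal (η * δ)) (.ofReal (1 + η ^ 2 * (2 * (Real.cosh ε - 1) + δ))) := by
    rw [comp_spikedLaw, ENNReal.ofReal_mul η.2.1, ENNReal.ofReal_add zero_le_one (by positivity),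
      ENNReal.ofReal_mul (by positivity), ENNReal.ofReal_pow η.2.1, ENNReal.ofReal_one]
    exact ((hQ i).hasTruncatedDensity x₀ u).mixture (ofReal_one_sub_add_ofReal η)
  convert HasTruncatedDensity.pi h using 1
  · simp [ENNReal.ofReal_mul]
  · rw [ENNReal.ofReal_pow (by positivity), Finset.prod_const, Finset.card_fin]

variable (B : Kernel (Fin n → Z) (Fin d → I)) [IsMarkovKernel B]

theorem measureReal_estimate_spikedLaw_le (hn : n ≠ 0) (hQ : ∀ i, IsLDP ε δ (Q i)) (x₀ u : Fin d)
    (η : I) {D : Set (Fin d → I)} (hD : MeasurableSet D) :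
    (B ∘ₘ Measure.pi fun i => Q i ∘ₘ spikedLaw x₀ u η).real D ≤ n * (η * δ) +
      √((1 + η ^ 2 * (2 * (Real.cosh ε - 1) + δ)) ^ n *
        (B ∘ₘ Measure.pi fun i => Q i x₀).real D) := by
  have hδ : 0 ≤ δ := (hQ ⟨0, Nat.pos_of_ne_zero hn⟩).nonneg x₀
  have hχ : 0 ≤ 2 * (Real.cosh ε - 1) + δ := by linarith [Real.one_le_cosh ε]
  have hη := η.2.1
  exact (hasTruncatedDensity_reports_spikedLaw hn hQ x₀ u η).measureReal_bind_le
    (by positivity) (by positivity) B hD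

theorem exists_one_le_expectedError_spikedLaw_add (hn : n ≠ 0) (hQ : ∀ i, IsLDP ε δ (Q i))
    (x₀ : Fin d) {η : I} (hη : 0 < η) :
    ∃ u, 1 ≤ expectedError (spikedLaw x₀ u η) Q B / (η / 4) + (n * (η * δ) +
      √((1 + η ^ 2 * (2 * (Real.cosh ε - 1) + δ)) ^ n * (d : ℝ)⁻¹)) +
      Real.exp (-(n * η / 10)) := by
  have hη' : (0 : ℝ) < η := hη
  have hχ : 0 ≤ 2 * (Real.cosh ε - 1) + δ := by
    linarith [Real.one_le_cosh ε, (hQ ⟨0, Nat.pos_of_ne_zero hn⟩).nonneg x₀]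
  have : Nonempty (Fin d) := ⟨x₀⟩
  obtain ⟨u, hu⟩ := exists_measureReal_le_inv_card (B ∘ₘ Measure.pi fun i => Q i x₀)
    (measurableSet_decodeSet x₀ (η / 4)) (pairwise_disjoint_decodeSet x₀ (η / 4))
  rw [Fintype.card_fin] at hu
  refine ⟨u, (one_le_expectedError_div_add (spikedLaw x₀ u η) (ae_spikedLaw x₀ u η) Q B
    (by positivity : (0 : ℝ) < η / 4)).trans (add_le_add (add_le_add le_rfl ?_) ?_)⟩
  · refine (measureReal_estimate_spikedLaw_le B hn hQ x₀ u η
      (measurableSet_decodeSet x₀ _ u)).trans ?_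
    gcongr
  · refine le_trans (measureReal_mono fun v hv => ?_)
      (measureReal_freq_le_le_exp _ hn (le_measureReal_spikedLaw_singleton x₀ u η))
    have hv' : freq v u < 2 * (η / 4) := hv
    exact hv'.le.trans_eq (by ring)

theorem exists_div_le_expectedError_spikedLaw (hn : n ≠ 0) (hQ : ∀ i, IsLDP ε δ (Q i))
    (x₀ : Fin d) {η : I} (hnδ : n * δ ≤ 1 / 50) (hnη : 40 ≤ n * (η : ℝ))
    (hd : n * ((η : ℝ) ^ 2 * (2 * (Real.cosh ε - 1) + δ)) ≤ Real.log d - 3 / 5) :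
    ∃ u, (η : ℝ) / 200 ≤ expectedError (spikedLaw x₀ u η) Q B := by
  have hd₀ : (0 : ℝ) < d := by exact_mod_cast x₀.pos
  have hη : (0 : ℝ) < η := pos_of_mul_pos_right (by linarith) n.cast_nonneg
  have hδ : 0 ≤ δ := (hQ ⟨0, Nat.pos_of_ne_zero hn⟩).nonneg x₀
  set χ := 2 * (Real.cosh ε - 1) + δ
  obtain ⟨u, hu⟩ := exists_one_le_expectedError_spikedLaw_add B hn hQ x₀ hη
  refine ⟨u, ?_⟩
  have hmass : n * ((η : ℝ) * δ) ≤ 1 / 50 := by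
    refine le_trans ?_ hnδ
    gcongr
    exact mul_le_of_le_one_left hδ η.2.2
  have hpow : (1 + η ^ 2 * χ) ^ n * (d : ℝ)⁻¹ ≤ Real.exp (-(3 / 10)) ^ 2 := by
    have hχ : 0 ≤ χ := by linarith [Real.one_le_cosh ε]
    calc (1 + η ^ 2 * χ) ^ n * (d : ℝ)⁻¹
        ≤ Real.exp (η ^ 2 * χ) ^ n * Real.exp (-Real.log d) := by
          rw [Real.exp_neg, Real.exp_log hd₀]
          gcongr
          rw [add_comm]
          exact Real.add_one_le_exp _
      _ = Real.exp (n * (η ^ 2 * χ) - Real.log d) := by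
          rw [← Real.exp_nat_mul, ← Real.exp_add, sub_eq_add_neg]
      _ ≤ Real.exp (2 * -(3 / 10)) := by gcongr; linarith
      _ = Real.exp (-(3 / 10)) ^ 2 := by rw [← Real.exp_nat_mul, Nat.cast_ofNat]
  have hsqrt : √((1 + η ^ 2 * χ) ^ n * (d : ℝ)⁻¹) ≤ 3 / 4 := by
    refine (Real.sqrt_le_left (Real.exp_pos _).le).2 hpow |>.trans ?_
    rw [Real.exp_neg]
    exact (inv_anti₀ (by norm_num) (Real.quadratic_le_exp_of_nonneg (by norm_num))).trans
      (by norm_num)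
  have htail : Real.exp (-(n * η / 10)) ≤ 1 / 5 := by
    calc Real.exp (-(n * η / 10)) ≤ Real.exp (-4) := by gcongr; linarith
      _ ≤ 1 / 5 := by
        rw [Real.exp_neg, one_div]
        exact inv_anti₀ (by norm_num) (by linarith [Real.add_one_le_exp (4 : ℝ)])
  have herror : 3 / 100 ≤ expectedError (spikedLaw x₀ u η) Q B / (η / 4) := by linarith
  rw [le_div_iff₀ (by positivity)] at herror
  linarith

theorem one_le_two_mul_expectedError_dirac_add (hn : n ≠ 0) (x₀ u : Fin d) :
    1 ≤ 2 * expectedError (.dirac u) Q B +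
      (B ∘ₘ Measure.pi fun i => Q i u).real (decodeSet x₀ (1 / 2) u) := by
  have h := one_le_expectedError_div_add (x₀ := x₀) (u := u) (.dirac u) (by simp [ae_dirac_eq]) Q B
    (one_half_pos (α := ℝ))
  have hrare :
      (Measure.pi fun _ : Fin n => Measure.dirac u).real {v | freq v u < 2 * (1 / 2)} = 0 := by
    rw [measureReal_eq_zero_iff, measure_eq_zero_iff_ae_notMem]
    filter_upwards [ae_pi_forall (fun _ : Fin n => Measure.dirac u) (p := fun _ x => x = u)
      fun _ => by simp [ae_dirac_eq]] with v hv
    simp [freq_eq_one hn hv]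
  simp_rw [Measure.dirac_bind (Q _).measurable] at h
  rw [hrare, add_zero] at h
  linarith

theorem exists_le_expectedError_dirac (hn : n ≠ 0) (hQ : ∀ i, IsLDP ε δ (Q i))
    {x₀ u : Fin d} (hu : x₀ ≠ u) (hnδ : n * δ ≤ 1 / 2) :
    ∃ x, 1 / (32 * (1 + (2 * (Real.cosh ε - 1) + δ)) ^ n) ≤ expectedError (.dirac x) Q B := by
  have hχ : 0 ≤ 2 * (Real.cosh ε - 1) + δ := by
    linarith [Real.one_le_cosh ε, (hQ ⟨0, Nat.pos_of_ne_zero hn⟩).nonneg x₀]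
  set k := (1 + (2 * (Real.cosh ε - 1) + δ)) ^ n
  have hk : 1 ≤ k := one_le_pow₀ (by linarith)
  by_contra! herror
  have htransfer := measureReal_estimate_spikedLaw_le B hn hQ x₀ u 1
    (measurableSet_decodeSet x₀ (1 / 2) u)
  simp only [comp_spikedLaw, Set.Icc.coe_one, sub_self, ENNReal.ofReal_zero, zero_smul, zero_add,
    ENNReal.ofReal_one, one_smul, one_pow, one_mul] at htransfer
  have hdisjoint : (B ∘ₘ Measure.pi fun i => Q i x₀).real (decodeSet x₀ (1 / 2) u) +
      (B ∘ₘ Measure.pi fun i => Q i x₀).real (decodeSet x₀ (1 / 2) x₀) ≤ 1 := by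
    rw [← measureReal_union (pairwise_disjoint_decodeSet x₀ (1 / 2) hu.symm)
      (measurableSet_decodeSet x₀ _ x₀)]
    exact measureReal_le_one
  have hbase := one_le_two_mul_expectedError_dirac_add (Q := Q) B hn x₀ x₀
  have hspike := one_le_two_mul_expectedError_dirac_add (Q := Q) B hn x₀ u
  have hconfused : k * (B ∘ₘ Measure.pi fun i => Q i x₀).real (decodeSet x₀ (1 / 2) u) ≤
      (1 / 4) ^ 2 := by
    have hlt := (lt_div_iff₀' (by positivity)).1 (herror x₀)
    nlinarith
  have hsqrt := (Real.sqrt_le_left (by norm_num)).2 hconfused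
  have hsmall : 1 / (32 * k) ≤ 1 / 32 := by gcongr; linarith
  linarith [herror u]

end LowerBounds

section Rate

variable {n d : ℕ} {C ε : ℝ}

theorem two_thirds_le_log_natCast {m : ℕ} (hm : 2 ≤ m) : 2 / 3 ≤ Real.log m := by
  have hlog : Real.log 2 ≤ Real.log m := Real.log_le_log two_pos (by exact_mod_cast hm)
  linarith [Real.log_two_gt_d9]

theorem two_mul_cosh_sub_one_le (hε : 0 ≤ ε) :
    2 * (Real.cosh ε - 1) ≤ ε ^ 2 * Real.exp ε := by
  have hsq : 2 * (Real.cosh ε - 1) = (1 - Real.exp (-ε)) ^ 2 * Real.exp ε := by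
    have hinv : Real.exp (-ε) * Real.exp ε = 1 := by
      rw [← Real.exp_add, neg_add_cancel, Real.exp_zero]
    rw [Real.cosh_eq]
    linear_combination (2 - Real.exp (-ε)) * hinv
  rw [hsq]
  gcongr
  · exact sub_nonneg.2 (Real.exp_le_one_iff.2 (by linarith))
  · linarith [Real.one_sub_le_exp_neg ε]

theorem exp_neg_half_sq_mul_two_mul_cosh_sub_one_le (hε : 0 ≤ ε) (hεC : ε ≤ C) :
    Real.exp (-(C / 2)) ^ 2 * (2 * (Real.cosh ε - 1)) ≤ ε ^ 2 :=
  calc Real.exp (-(C / 2)) ^ 2 * (2 * (Real.cosh ε - 1))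
      ≤ Real.exp (-(C / 2)) ^ 2 * (ε ^ 2 * Real.exp ε) := by
        gcongr _ * ?_
        exact two_mul_cosh_sub_one_le hε
    _ = ε ^ 2 * Real.exp (ε - C) := by
        rw [mul_left_comm, ← Real.exp_nat_mul, ← Real.exp_add]
        ring_nf
    _ ≤ ε ^ 2 := mul_le_of_le_one_right (sq_nonneg ε) (Real.exp_le_one_iff.2 (by linarith))

/-- The minimax rate of the error of `ε`-locally private histograms, up to constants. -/
noncomputable def errorRate (ε : ℝ) (n d : ℕ) : ℝ := min (1 / ε * √(Real.log d / n)) 1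

theorem errorRate_nonneg (hε : 0 ≤ ε) (n d : ℕ) : 0 ≤ errorRate ε n d := by
  unfold errorRate; positivity

theorem errorRate_le_one (ε : ℝ) (n d : ℕ) : errorRate ε n d ≤ 1 := min_le_right _ _

theorem natCast_mul_errorRate_mul_sq_le (hε : 0 < ε) (n d : ℕ) :
    n * (ε * errorRate ε n d) ^ 2 ≤ Real.log d := by
  have hle : ε * errorRate ε n d ≤ √(Real.log d / n) :=
    calc ε * errorRate ε n d ≤ ε * (1 / ε * √(Real.log d / n)) := by
          gcongr; exact min_le_left _ _
      _ = √(Real.log d / n) := by field_simp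
  have h₀ := errorRate_nonneg hε.le n d
  calc n * (ε * errorRate ε n d) ^ 2 ≤ n * √(Real.log d / n) ^ 2 := by gcongr
    _ = n * (Real.log d / n) := by rw [Real.sq_sqrt (by positivity)]
    _ ≤ Real.log d := by
      rcases eq_or_ne n 0 with rfl | hn
      · simp [Real.log_natCast_nonneg]
      · field_simp; rfl

theorem natCast_le_of_mul_errorRate_le {H : ℝ} (hε : 0 < ε) (hεC : ε ≤ C) (hd : 2 ≤ d)
    (h : n * errorRate ε n d ≤ H) : n ≤ H + 2 * (H * C) ^ 2 := by
  rcases le_total (1 / ε * √(Real.log d / n)) 1 with hle | hle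
  · rw [errorRate, min_eq_left hle] at h
    have hH : 0 ≤ H := le_trans (by positivity) h
    have hHC : n * √(Real.log d / n) ≤ H * C := by
      calc n * √(Real.log d / n) = n * (1 / ε * √(Real.log d / n)) * ε := by field_simp
        _ ≤ H * C := by gcongr
    have hsq : (n * √(Real.log d / n)) ^ 2 = n * Real.log d := by
      rw [mul_pow, Real.sq_sqrt (by positivity)]
      rcases eq_or_ne n 0 with rfl | hn
      · simp
      · field_simp
    have hlog := two_thirds_le_log_natCast hd
    have hle : n * Real.log d ≤ (H * C) ^ 2 := hsq ▸ pow_le_pow_left₀ (by positivity) hHC 2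
    nlinarith [n.cast_nonneg (α := ℝ)]
  · rw [errorRate, min_eq_right hle, mul_one] at h
    linarith [sq_nonneg (H * C)]

theorem div_mul_log_le_div {κ : ℝ} (hκ : 0 ≤ κ) {n : ℕ} (hn : 2 ≤ n) :
    κ / 2 / (n * Real.log n) ≤ κ / n := by
  rw [div_div]
  gcongr
  nlinarith [two_thirds_le_log_natCast hn, n.cast_nonneg (α := ℝ)]

end Rate

section MainBounds

variable {n d : ℕ} {Z : Type*} [MeasurableSpace Z] {C ε δ : ℝ} {Q : Fin n → Kernel (Fin d) Z}
  [∀ i, IsMarkovKernel (Q i)] (B : Kernel (Fin n → Z) (Fin d → I)) [IsMarkovKernel B]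

theorem exists_mul_errorRate_le_of_many_users (hn : n ≠ 0) (hd : 2 ≤ d) (hε : 0 < ε)
    (hεC : ε ≤ C) (hnδ : n * δ ≤ 1 / 50) (hQ : ∀ i, IsLDP ε δ (Q i))
    (hlarge : 200 * Real.exp (C / 2) ≤ n * errorRate ε n d) :
    ∃ P : Measure (Fin d), IsProbabilityMeasure P ∧
      Real.exp (-(C / 2)) / 1000 * errorRate ε n d ≤ expectedError P Q B := by
  have hrate := errorRate_nonneg hε.le n d
  let η : I := ⟨Real.exp (-(C / 2)) / 5 * errorRate ε n d, by positivity,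
    mul_le_one₀ (by linarith [Real.exp_le_one_iff.2 (by linarith : -(C / 2) ≤ 0)]) hrate
      (errorRate_le_one ε n d)⟩
  have hnη : 40 ≤ n * (η : ℝ) := by
    calc 40 = Real.exp (-(C / 2)) / 5 * (200 * Real.exp (C / 2)) := by
          rw [Real.exp_neg]; field_simp; norm_num
      _ ≤ Real.exp (-(C / 2)) / 5 * (n * errorRate ε n d) := by gcongr
      _ = n * (η : ℝ) := by ring
  have hχ : n * ((η : ℝ) ^ 2 * (2 * (Real.cosh ε - 1) + δ)) ≤ Real.log d - 3 / 5 := by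
    have hδ : (η : ℝ) ^ 2 * (n * δ) ≤ 1 / 50 :=
      (mul_le_mul_of_nonneg_left hnδ (sq_nonneg _)).trans
        (mul_le_of_le_one_left (by norm_num) (pow_le_one₀ η.2.1 η.2.2))
    calc n * ((η : ℝ) ^ 2 * (2 * (Real.cosh ε - 1) + δ))
        = n * errorRate ε n d ^ 2 * (Real.exp (-(C / 2)) ^ 2 * (2 * (Real.cosh ε - 1))) / 25 +
            (η : ℝ) ^ 2 * (n * δ) := by ring
      _ ≤ n * errorRate ε n d ^ 2 * ε ^ 2 / 25 + 1 / 50 := by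
          gcongr ?_ / _ + ?_
          exact mul_le_mul_of_nonneg_left
            (exp_neg_half_sq_mul_two_mul_cosh_sub_one_le hε.le hεC) (by positivity)
      _ = n * (ε * errorRate ε n d) ^ 2 / 25 + 1 / 50 := by ring
      _ ≤ Real.log d / 25 + 1 / 50 := by
          gcongr
          exact natCast_mul_errorRate_mul_sq_le hε n d
      _ ≤ Real.log d - 3 / 5 := by linarith [two_thirds_le_log_natCast hd]
  obtain ⟨u, hu⟩ := exists_div_le_expectedError_spikedLaw B hn hQ ⟨0, by lia⟩ hnδ hnη hχ
  refine ⟨spikedLaw _ u η, inferInstance, hu.trans' (le_of_eq ?_)⟩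
  ring

theorem exists_le_expectedError_of_few_users {N : ℕ} (hn : n ≠ 0) (hnN : n ≤ N) (hd : 2 ≤ d)
    (hε : 0 ≤ ε) (hεC : ε ≤ C) (hnδ : n * δ ≤ 1 / 50) (hQ : ∀ i, IsLDP ε δ (Q i)) :
    ∃ P : Measure (Fin d), IsProbabilityMeasure P ∧
      1 / (32 * (2 * Real.exp C) ^ N) ≤ expectedError P Q B := by
  have hn₁ : (1 : ℝ) ≤ n := by exact_mod_cast Nat.one_le_iff_ne_zero.2 hn
  obtain ⟨x, hx⟩ := exists_le_expectedError_dirac B hn hQ (x₀ := ⟨0, by lia⟩) (u := ⟨1, by lia⟩)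
    (by simp) (by linarith)
  refine ⟨.dirac x, inferInstance, le_trans ?_ hx⟩
  have hδ : 0 ≤ δ := (hQ ⟨0, Nat.pos_of_ne_zero hn⟩).nonneg x
  have hexp : 1 ≤ Real.exp C := Real.one_le_exp (hε.trans hεC)
  have hbase : 1 + (2 * (Real.cosh ε - 1) + δ) ≤ 2 * Real.exp C := by
    have hcosh : 2 * Real.cosh ε ≤ Real.exp C + 1 := by
      rw [Real.cosh_eq]
      linarith [Real.exp_le_exp.2 hεC, Real.exp_le_one_iff.2 (neg_nonpos.2 hε)]
    nlinarith
  have hχ : 0 ≤ 2 * (Real.cosh ε - 1) + δ := by linarith [Real.one_le_cosh ε]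
  gcongr 1 / (32 * ?_)
  calc (1 + (2 * (Real.cosh ε - 1) + δ)) ^ n ≤ (2 * Real.exp C) ^ n := by
        gcongr
    _ ≤ (2 * Real.exp C) ^ N := pow_le_pow_right₀ (by linarith) hnN

end MainBounds

theorem mainTheorem1_general (C : ℝ) :
    ∃ c κ : ℝ, 0 < c ∧ 0 < κ ∧
      ∀ (n d : ℕ), 1 ≤ n → 1 ≤ d →
      ∀ ε δ : ℝ, 0 < ε → ε ≤ C → δ ≤ κ / n →
      ∀ (Z : Type*) [MeasurableSpace Z]
        (Q : Fin n → Kernel (Fin d) Z) [∀ i, IsMarkovKernel (Q i)],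
        (∀ i, IsLDP ε δ (Q i)) →
      ∀ (B : Kernel (Fin n → Z) (Fin d → Set.Icc (0 : ℝ) 1)) [IsMarkovKernel B],
        ∃ P : Measure (Fin d), IsProbabilityMeasure P ∧
          c * min (1 / ε * Real.sqrt (Real.log d / n)) 1 ≤ expectedError P Q B := by
  set H := 200 * Real.exp (C / 2)
  set N := ⌈H + 2 * (H * C) ^ 2⌉₊
  refine ⟨min (Real.exp (-(C / 2)) / 1000) (1 / (32 * (2 * Real.exp C) ^ N)), 1 / 50,
    by positivity, by norm_num, fun n d hn hd ε δ hε hεC hδ Z _ Q _ hQ B _ => ?_⟩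
  have hn₀ : n ≠ 0 := Nat.one_le_iff_ne_zero.1 hn
  have hnδ : n * δ ≤ 1 / 50 := (le_div_iff₀' (by positivity)).1 hδ
  have hrate := errorRate_nonneg hε.le n d
  rcases hd.eq_or_lt with rfl | hd
  · refine ⟨.dirac 0, inferInstance, le_trans (le_of_eq ?_) (expectedError_nonneg _ Q B)⟩
    simp
  rcases le_total H (n * errorRate ε n d) with hlarge | hsmall
  · obtain ⟨P, hP, hle⟩ := exists_mul_errorRate_le_of_many_users B hn₀ hd hε hεC hnδ hQ hlarge
    exact ⟨P, hP, hle.trans' (mul_le_mul_of_nonneg_right (min_le_left _ _) hrate)⟩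
  · have hnN : n ≤ N := Nat.cast_le (α := ℝ).1 <|
      (natCast_le_of_mul_errorRate_le hε hεC hd hsmall).trans (Nat.le_ceil _)
    obtain ⟨P, hP, hle⟩ := exists_le_expectedError_of_few_users B hn₀ hnN hd hε.le hεC hnδ hQ
    refine ⟨P, hP, hle.trans' ?_⟩
    exact (mul_le_of_le_one_right (by positivity) (errorRate_le_one ε n d)).trans (min_le_right _ _)

theorem mainTheorem1 (C : ℝ) (hC : 0 < C) :
    ∃ c κ : ℝ, 0 < c ∧ 0 < κ ∧
      ∀ (n d : ℕ), 2 ≤ n → 1 ≤ d →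
      ∀ ε δ : ℝ, 0 < ε → ε ≤ C → 0 ≤ δ → δ ≤ κ / (n * Real.log n) →
      ∀ (Z : Type*) [MeasurableSpace Z]
        (Q : Fin n → Kernel (Fin d) Z) [∀ i, IsMarkovKernel (Q i)],
        (∀ i, IsLDP ε δ (Q i)) →
      ∀ (B : Kernel (Fin n → Z) (Fin d → Set.Icc (0 : ℝ) 1)) [IsMarkovKernel B],
        ∃ P : Measure (Fin d), IsProbabilityMeasure P ∧
          c * min (1 / ε * Real.sqrt (Real.log d / n)) 1 ≤ expectedError P Q B := by
  obtain ⟨c, κ, hc, hκ, h⟩ := mainTheorem1_general C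
  exact ⟨c, κ / 2, hc, half_pos hκ, fun n d hn hd ε δ hε hεC _ hδ =>
    h n d (one_le_two.trans hn) hd ε δ hε hεC (hδ.trans (div_mul_log_le_div hκ.le hn))⟩
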